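/- **Swing Lemma.** Let $L$ be a finite lattice that is semimodular (if $a\wedge b\prec a$ then $b\prec a\vee b$), slim (it has no sublattice isomorphic to the five-element modular nondistributive lattice $M_3$) and planar, and fix any planar diagram of $L$ (elements drawn as distinct points, larger elements higher, covering pairs drawn as straight line segments that pass through no other point of the diagram and meet one another only at endpoints). A prime interval $\mathfrak p=[0_{\mathfrak p},1_{\mathfrak p}]$ of $L$ is an interval with $0_{\mathfrak p}\prec 1_{\mathfrak p}$; $\operatorname{con}(\mathfrak p)$ is the least congruence of $L$ identifying $0_{\mathfrak p}$ and $1_{\mathfrak p}$, and a congruence collapses $\mathfrak q$ if it identifies $0_{\mathfrak q}$ and $1_{\mathfrak q}$. For prime intervals $\mathfrak p,\mathfrak q$ of $L$: - $\mathfrak p$ is *down-perspective* to $\mathfrak q$ if $0_{\mathfrak p}\vee 1_{\mathfrak q}=1_{\mathfrak p}$ and $0_{\mathfrak p}\wedge 1_{\mathfrak q}=0_{\mathfrak q}$; dually, $\mathfrak p$ is *up-perspective* to $\mathfrak q$ if $1_{\mathfrak p}\wedge 0_{\mathfrak q}=0_{\mathfrak p}$ and $1_{\mathfrak p}\vee 0_{\mathfrak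 q}=1_{\mathfrak q}$; - $\mathfrak p$ *swings* to $\mathfrak q$ if $1_{\mathfrak p}=1_{\mathfrak q}$, this element covers at least three elements, and $0_{\mathfrak q}$ is neither the left-most nor the right-most element covered by it in the diagram (the elements covered by $t$ being ordered from left to right as the edges going down from $t$ are). Let $\mathfrak p\neq\mathfrak q$ be prime intervals of $L$. Then $\mathfrak q$ is collapsed by $\operatorname{con}(\mathfrak p)$ if and only if there exist a prime interval $\mathfrak r$ such that $\mathfrak p$ is up-perspective to $\mathfrak r$, an integer $n\ge 0$, and prime intervals $\mathfrak r=\mathfrak r_0,\mathfrak r_1,\dots,\mathfrak r_n=\mathfrak q$ such that, for each $1\le i\le n$, $\mathfrak r_{i-1}$ is down-perspective to $\mathfrak r_i$ or swings to $\mathfrak r_i$. In addition, every such sequence satisfies $1_{\mathfrak r_0}\ge 1_{\mathfrak r_1}\ge\dots\ge 1_{\mathfrak r_n}$. -/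

import Mathlib

namespace SwingLemma

/-- A prime interval `[bot, top]`, i.e. an interval with `bot` covered by `top`. -/
@[ext]
structure PrimeInterval (L : Type*) [Lattice L] where
  bot : L
  top : L
  covBy : bot ⋖ top

/-- A lattice is slim if it has no sublattice `{o, a, b, c, i}` isomorphic to the five-element
modular nondistributive lattice (bottom `o`, top `i`, and three atoms `a`, `b`, `c`). -/
def IsSlim (L : Type*) [Lattice L] : Prop :=
  ¬ ∃ o a b c i : L, [o, a, b, c, i].Nodup ∧
    (a ⊓ b = o ∧ a ⊓ c = o ∧ b ⊓ c = o) ∧ (a ⊔ b = i ∧ a ⊔ c = i ∧ b ⊔ c = i)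

/-- A planar (Hasse) diagram of an ordered set: elements are drawn as distinct points of the plane,
larger elements are drawn higher, each covering pair is drawn as a straight line segment, no
segment passes through a point of the diagram other than its endpoints, and two distinct segments
do not meet except possibly at endpoints. -/
structure PlanarDiagram (L : Type*) [PartialOrder L] where
  pt : L → ℝ × ℝ
  pt_injective : Function.Injective pt
  height_lt : ∀ ⦃a b : L⦄, a < b → (pt a).2 < (pt b).2
  notMem_edge : ∀ ⦃a b : L⦄, a ⋖ b → ∀ c : L, pt c ∉ openSegment ℝ (pt a) (pt b)
  edges_disjoint : ∀ ⦃a b c d : L⦄, a ⋖ b → c ⋖ d → (a, b) ≠ (c, d) →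
    Disjoint (openSegment ℝ (pt a) (pt b)) (openSegment ℝ (pt c) (pt d))

section Diagram

variable {L : Type*} [Lattice L]

/-- For `a ⋖ t`, the horizontal displacement per unit of descent along the edge that goes from `t`
down to `a`.  The edges going down from `t` are ordered from left to right by this number. -/
noncomputable def PlanarDiagram.direction (D : PlanarDiagram L) (t a : L) : ℝ :=
  ((D.pt a).1 - (D.pt t).1) / ((D.pt t).2 - (D.pt a).2)

/-- `a` is the left-most element covered by `t`. -/
def PlanarDiagram.IsLeftmost (D : PlanarDiagram L) (t a : L) : Prop :=
  a ⋖ t ∧ ∀ b : L, b ⋖ t → D.direction t a ≤ D.direction t b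

/-- `a` is the right-most element covered by `t`. -/
def PlanarDiagram.IsRightmost (D : PlanarDiagram L) (t a : L) : Prop :=
  a ⋖ t ∧ ∀ b : L, b ⋖ t → D.direction t b ≤ D.direction t a

/-- `p` swings to `q`: they have the same top, this top covers at least three elements, and the
bottom of `q` is neither the left-most nor the right-most element covered by the top. -/
def Swings (D : PlanarDiagram L) (p q : PrimeInterval L) : Prop :=
  p.top = q.top ∧ 3 ≤ {x : L | x ⋖ q.top}.ncard ∧
    ¬ D.IsLeftmost q.top q.bot ∧ ¬ D.IsRightmost q.top q.bot

/-- `p` is down-perspective to `q`. -/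
def DownPersp (p q : PrimeInterval L) : Prop :=
  p.bot ⊔ q.top = p.top ∧ p.bot ⊓ q.top = q.bot

/-- `p` is up-perspective to `q`. -/
def UpPersp (p q : PrimeInterval L) : Prop :=
  p.top ⊓ q.bot = p.bot ∧ p.top ⊔ q.bot = q.top

/-- The principal congruence `con(a, b)`: the intersection of all the congruences that identify
`a` and `b`. -/
def principalCon (a b : L) : LatticeCon L where
  r x y := ∀ c : LatticeCon L, c.r a b → c.r x y
  iseqv :=
    { refl := fun x c _ => c.iseqv.refl x
      symm := fun h c hc => c.iseqv.symm (h c hc)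
      trans := fun h h' c hc => c.iseqv.trans (h c hc) (h' c hc) }
  inf := fun h h' c hc => c.inf (h c hc) (h' c hc)
  sup := fun h h' c hc => c.sup (h c hc) (h' c hc)

/-- `con(p)`, the congruence generated by the prime interval `p`. -/
def con (p : PrimeInterval L) : LatticeCon L :=
  principalCon p.bot p.top

/-- `q` is collapsed by the congruence `c`. -/
def Collapsed (c : LatticeCon L) (q : PrimeInterval L) : Prop :=
  c.r q.bot q.top

/-- `s 0, s 1, …, s n` is a sequence of prime intervals from `r` to `q` in which each step is a
down-perspectivity or a swing. -/
def IsSlideSwingSeq (D : PlanarDiagram L) (r q : PrimeInterval L) (n : ℕ)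
    (s : Fin (n + 1) → PrimeInterval L) : Prop :=
  s 0 = r ∧ s (Fin.last n) = q ∧
    ∀ i : Fin n, DownPersp (s i.castSucc) (s i.succ) ∨ Swings D (s i.castSucc) (s i.succ)

end Diagram

end SwingLemma

/-! Collapse survives every allowed move, which gives one direction. For the other, the equivalence
relation generated by the prime intervals reachable from p is a congruence (`reachableCon`)
identifying the ends of p, so it contains con(p); and every prime interval it collapses is itself
reachable (`reachable_of_eqvGen`).

Two closure properties carry this. `reflTransGen_step_of_inf_le` gives closure under meets: a prime
interval q with q.top ≤ p.top and p.bot ⊓ q.top ≤ q.bot can be reached from p, a swing being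
inserted wherever three lower covers get in the way. `Reachable.upPersp` gives closure under joins:
a later upward move is absorbed into the sequence, because slimness forbids three upper covers of
one element.

The diagram, or its dual, enters only through lower covers of one element: their directions are
distinct, a middle one is above the meet of the outer two, and an inner one has a single upper
cover. The last two come from the intermediate value theorem for paths viewed as functions of
height. -/

namespace SwingLemma

/-! ### Planar geometry of lower covers. -/

section Geometry

variable {L : Type*}

namespace PlanarDiagram

section Order

variable [PartialOrder L] (D : PlanarDiagram L)

/-- The mirror image of a diagram in a vertical line. -/
def mirror : PlanarDiagram L where
  pt a := (-(D.pt a).1, (D.pt a).2)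
  pt_injective a b h := by
    simp only [Prod.mk.injEq, neg_inj] at h
    exact D.pt_injective (Prod.ext h.1 h.2)
  height_lt a b h := D.height_lt h
  notMem_edge a b hab c hc := by
    apply D.notMem_edge hab c
    obtain ⟨s, t, hs, ht, hst, h⟩ := hc
    refine ⟨s, t, hs, ht, hst, ?_⟩
    simp only [Prod.ext_iff, Prod.fst_add, Prod.snd_add, Prod.smul_fst, Prod.smul_snd,
      smul_eq_mul] at h ⊢
    exact ⟨by linarith [h.1], h.2⟩
  edges_disjoint a b c d hab hcd hne := by
    rw [Set.disjoint_left]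
    rintro P ⟨s, t, hs, ht, hst, h⟩ ⟨s', t', hs', ht', hst', h'⟩
    have key := Set.disjoint_left.1 (D.edges_disjoint hab hcd hne)
    refine @key (-P.1, P.2)
      ⟨s, t, hs, ht, hst, ?_⟩ ⟨s', t', hs', ht', hst', ?_⟩ <;>
    · simp only [Prod.ext_iff, Prod.fst_add, Prod.snd_add, Prod.smul_fst, Prod.smul_snd,
        smul_eq_mul] at h h' ⊢
      constructor <;> linarith [h.1, h'.1, h.2, h'.2]

/-- The diagram of the dual order obtained by turning a diagram upside down. -/
def dual : PlanarDiagram Lᵒᵈ where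
  pt a := ((D.pt (OrderDual.ofDual a)).1, -(D.pt (OrderDual.ofDual a)).2)
  pt_injective a b h := by
    simp only [Prod.mk.injEq, neg_inj] at h
    exact D.pt_injective (Prod.ext h.1 h.2)
  height_lt a b h := neg_lt_neg (D.height_lt (OrderDual.ofDual_lt_ofDual.2 h))
  notMem_edge a b hab c hc := by
    apply D.notMem_edge hab.ofDual (OrderDual.ofDual c)
    obtain ⟨s, t, hs, ht, hst, h⟩ := hc
    refine ⟨t, s, ht, hs, by linarith, ?_⟩
    simp only [Prod.ext_iff, Prod.fst_add, Prod.snd_add, Prod.smul_fst, Prod.smul_snd,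
      smul_eq_mul] at h ⊢
    constructor <;> linarith [h.1, h.2]
  edges_disjoint a b c d hab hcd hne := by
    rw [Set.disjoint_left]
    rintro P ⟨s, t, hs, ht, hst, h⟩ ⟨s', t', hs', ht', hst', h'⟩
    have key := Set.disjoint_left.1 (D.edges_disjoint hab.ofDual hcd.ofDual fun h => hne (by
      simp only [Prod.mk.injEq, OrderDual.ofDual_inj] at h
      rw [h.1, h.2]))
    refine @key (P.1, -P.2) ⟨t, s, ht, hs, by linarith, ?_⟩ ⟨t', s', ht', hs', by linarith, ?_⟩ <;>
    · simp only [Prod.ext_iff, Prod.fst_add, Prod.snd_add, Prod.smul_fst, Prod.smul_snd,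
        smul_eq_mul] at h h' ⊢
      constructor <;> linarith [h.1, h'.1, h.2, h'.2]

/-- The point `P` is an element of `[a, b]` or lies inside an edge of `[a, b]`. -/
def OnDiagram (a b : L) (P : ℝ × ℝ) : Prop :=
  (∃ w, a ≤ w ∧ w ≤ b ∧ D.pt w = P) ∨
    ∃ u v, a ≤ u ∧ u ⋖ v ∧ v ≤ b ∧ P ∈ openSegment ℝ (D.pt u) (D.pt v)

variable {D}

theorem OnDiagram.mono {a b a' b' : L} {P : ℝ × ℝ} (h : D.OnDiagram a b P) (ha : a' ≤ a)
    (hb : b ≤ b') : D.OnDiagram a' b' P := by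
  rcases h with ⟨w, h1, h2, h3⟩ | ⟨u, v, h1, h2, h3, h4⟩
  · exact Or.inl ⟨w, ha.trans h1, h2.trans hb, h3⟩
  · exact Or.inr ⟨u, v, ha.trans h1, h2, h3.trans hb, h4⟩

theorem OnDiagram.le_of_mem_edge {a b u v : L} {P : ℝ × ℝ} (h : D.OnDiagram a b P) (huv : u ⋖ v)
    (hP : P ∈ openSegment ℝ (D.pt u) (D.pt v)) : a ≤ u ∧ v ≤ b := by
  rcases h with ⟨w, -, -, h3⟩ | ⟨u', v', h1, h2, h3, h4⟩
  · exact absurd (h3 ▸ hP) (D.notMem_edge huv w)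
  · by_cases he : (u, v) = (u', v')
    · simp only [Prod.mk.injEq] at he
      exact ⟨he.1 ▸ h1, he.2 ▸ h3⟩
    · exact (Set.disjoint_left.1 (D.edges_disjoint huv h2 he) hP h4).elim

theorem OnDiagram.mem_Icc {a b w : L} (h : D.OnDiagram a b (D.pt w)) : a ≤ w ∧ w ≤ b := by
  rcases h with ⟨w', h1, h2, h3⟩ | ⟨u', v', h1, h2, h3, h4⟩
  · exact D.pt_injective h3 ▸ ⟨h1, h2⟩
  · exact absurd h4 (D.notMem_edge h2 w)

/-- This is how planarity becomes order: edges meet only at elements or coincide, so intersecting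
paths yield comparabilities. -/
theorem OnDiagram.exists_common {a b a' b' : L} {P : ℝ × ℝ} (h : D.OnDiagram a b P)
    (h' : D.OnDiagram a' b' P) : ∃ w, a ≤ w ∧ w ≤ b ∧ a' ≤ w ∧ w ≤ b' := by
  rcases h with ⟨w, h1, h2, rfl⟩ | ⟨u, v, h1, h2, h3, h4⟩
  · exact ⟨w, h1, h2, h'.mem_Icc⟩
  · have := h'.le_of_mem_edge h2 h4
    exact ⟨u, h1, h2.le.trans h3, this.1, h2.le.trans this.2⟩

end Order

variable [Lattice L] (D : PlanarDiagram L)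

/-- The horizontal coordinate, as a function of the height, of the line through `t` and `a`. -/
noncomputable def line (t a : L) (y : ℝ) : ℝ :=
  (D.pt t).1 + D.direction t a * ((D.pt t).2 - y)

variable {D}

theorem continuous_line (t a : L) : Continuous (D.line t a) := by
  unfold line
  fun_prop

theorem line_top (t a : L) : D.line t a (D.pt t).2 = (D.pt t).1 := by
  simp [line]

theorem line_bot {t a : L} (h : a < t) : D.line t a (D.pt a).2 = (D.pt a).1 := by
  have : (D.pt t).2 - (D.pt a).2 ≠ 0 := (sub_pos.2 (D.height_lt h)).ne'
  simp only [line, direction]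
  field_simp
  ring

theorem line_mem_edge {t a : L} (h : a < t) {y : ℝ} (h1 : (D.pt a).2 < y) (h2 : y < (D.pt t).2) :
    (D.line t a y, y) ∈ openSegment ℝ (D.pt a) (D.pt t) := by
  have h0 : 0 < (D.pt t).2 - (D.pt a).2 := sub_pos.2 (D.height_lt h)
  refine ⟨((D.pt t).2 - y) / ((D.pt t).2 - (D.pt a).2),
    (y - (D.pt a).2) / ((D.pt t).2 - (D.pt a).2), div_pos (by linarith) h0,
    div_pos (by linarith) h0, by field_simp; ring, ?_⟩
  simp only [Prod.ext_iff, Prod.fst_add, Prod.snd_add, Prod.smul_fst, Prod.smul_snd,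
    smul_eq_mul, line, direction]
  constructor <;> field_simp <;> ring

theorem line_onDiagram {t a : L} (h : a ⋖ t) {y : ℝ} (h1 : (D.pt a).2 ≤ y)
    (h2 : y ≤ (D.pt t).2) : D.OnDiagram a t (D.line t a y, y) := by
  rcases h1.eq_or_lt with rfl | h1
  · exact Or.inl ⟨a, le_rfl, h.le, by rw [line_bot h.lt]⟩
  rcases h2.eq_or_lt with rfl | h2
  · exact Or.inl ⟨t, h.le, le_rfl, by rw [line_top]⟩
  exact Or.inr ⟨a, t, le_rfl, h, le_rfl, line_mem_edge h.lt h1 h2⟩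

theorem direction_injective {t a b : L} (ha : a ⋖ t) (hb : b ⋖ t)
    (h : D.direction t a = D.direction t b) : a = b := by
  by_contra hne
  have h1 := D.height_lt ha.lt
  have h2 := D.height_lt hb.lt
  obtain ⟨y, hy1, hy2⟩ := exists_between (max_lt h1 h2)
  rw [max_lt_iff] at hy1
  refine Set.disjoint_left.1 (D.edges_disjoint ha hb (by simpa using hne))
    (line_mem_edge ha.lt hy1.1 hy2) ?_
  have : D.line t a y = D.line t b y := by rw [line, line, h]
  rw [this]
  exact line_mem_edge hb.lt hy1.2 hy2

variable (D) in
/-- `f` is the graph, over the heights, of a path along edges that goes from `a` up to `b`. -/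
structure IsPath (a b : L) (f : ℝ → ℝ) : Prop where
  continuous : Continuous f
  bot : f (D.pt a).2 = (D.pt a).1
  top : f (D.pt b).2 = (D.pt b).1
  onDiagram : ∀ y, (D.pt a).2 ≤ y → y ≤ (D.pt b).2 → D.OnDiagram a b (f y, y)

theorem height_le {a b : L} (h : a ≤ b) : (D.pt a).2 ≤ (D.pt b).2 := by
  rcases h.eq_or_lt with rfl | h
  · rfl
  · exact (D.height_lt h).le

theorem IsPath.trans {a b c : L} {f g : ℝ → ℝ} (hab : a ≤ b) (hbc : b ≤ c)
    (hf : D.IsPath a b f) (hg : D.IsPath b c g) :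
    D.IsPath a c (fun y => if y ≤ (D.pt b).2 then f y else g y) where
  continuous := Continuous.if_le hf.continuous hg.continuous continuous_id continuous_const (by
    rintro y rfl
    exact hf.top.trans hg.bot.symm)
  bot := by rw [if_pos (height_le hab), hf.bot]
  top := by
    split_ifs with h
    · have : (D.pt c).2 = (D.pt b).2 := le_antisymm h (height_le hbc)
      have hcb : ¬ b < c := fun h' => (D.height_lt h').ne' this
      obtain rfl := hbc.eq_of_not_lt hcb
      exact hf.top
    · exact hg.top
  onDiagram y h1 h2 := by
    split_ifs with h
    · exact (hf.onDiagram y h1 h).mono le_rfl hbc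
    · exact (hg.onDiagram y (not_le.1 h).le h2).mono hab le_rfl

theorem isPath_line {a t : L} (h : a ⋖ t) : D.IsPath a t (D.line t a) :=
  ⟨continuous_line t a, line_bot h.lt, line_top t a, fun _ => line_onDiagram h⟩

theorem exists_isPath [Finite L] {a b : L} (h : a ≤ b) : ∃ f, D.IsPath a b f := by
  induction b using WellFoundedLT.induction with
  | ind b ih =>
    rcases h.eq_or_lt with rfl | h
    · exact ⟨fun _ => (D.pt a).1, continuous_const, rfl, rfl, fun y h1 h2 =>
        Or.inl ⟨a, le_rfl, le_rfl, Prod.ext rfl (le_antisymm h1 h2)⟩⟩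
    · obtain ⟨u, hau, hub⟩ := exists_le_covBy_of_lt h
      obtain ⟨f, hf⟩ := ih u hub.lt hau
      exact ⟨_, hf.trans hau hub.le (isPath_line hub)⟩

/-- Two continuous functions that change their order agree somewhere in between. -/
theorem exists_eq_of_lt_of_le {f g : ℝ → ℝ} (hf : Continuous f) (hg : Continuous g) {y z : ℝ}
    (h1 : f y < g y) (h2 : g z ≤ f z) : ∃ w ∈ Set.uIcc y z, f w = g w := by
  have := intermediate_value_uIcc (f := fun x => g x - f x) (a := y) (b := z)
    (hg.sub hf).continuousOn
  obtain ⟨w, hw, hw'⟩ := this (show (0 : ℝ) ∈ _ by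
    rw [Set.mem_uIcc]; right; constructor <;> linarith)
  exact ⟨w, hw, by simp only at hw'; linarith⟩

/-- The path through `l` stays to the left of an edge that leaves `t` to the right of `l`. -/
theorem path_lt_line [Finite L] {g l m t : L} (hgl : g ≤ l) (hl : l ⋖ t) (hm : m ⋖ t)
    (hd : D.direction t l < D.direction t m) :
    ∃ f, D.IsPath g t f ∧ ∀ y, (D.pt g).2 ≤ y → (D.pt m).2 ≤ y → y < (D.pt t).2 →
      f y < D.line t m y := by
  obtain ⟨f, hf⟩ := exists_isPath (D := D) hgl
  have hp := hf.trans hgl hl.le (isPath_line hl)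
  refine ⟨_, hp, fun y h1 h2 h3 => ?_⟩
  set F : ℝ → ℝ := fun y => if y ≤ (D.pt l).2 then f y else D.line t l y with hF
  have hlm : ¬ m ≤ l := fun h => by
    rcases h.eq_or_lt with rfl | h
    · exact hd.false
    · exact hm.2 h hl.lt
  by_contra! hle
  -- At a height `z` above both `l` and `y`, the two curves are straight edges out of `t`, ordered
  -- by direction. A crossing further down would have to lie on the part of the path below `l`,
  -- which would put `m` below `l`.
  obtain ⟨z, hz1, hz2⟩ := exists_between (max_lt h3 (D.height_lt hl.lt))
  rw [max_lt_iff] at hz1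
  have hz : F z < D.line t m z := by
    simp only [hF, if_neg (not_le.2 hz1.2), line]
    have := mul_lt_mul_of_pos_right hd (sub_pos.2 hz2)
    linarith
  obtain ⟨w, hw, hw'⟩ := exists_eq_of_lt_of_le hp.continuous (continuous_line t m) hz hle
  rw [Set.uIcc_of_ge hz1.1.le, Set.mem_Icc] at hw
  have hon : D.OnDiagram m t (D.line t m w, w) := line_onDiagram hm (by linarith) (by linarith)
  by_cases hwl : w ≤ (D.pt l).2
  · have hon' : D.OnDiagram g l (F w, w) := by
      simp only [hF, if_pos hwl]
      exact hf.onDiagram w (by linarith) hwl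
    rw [hw'] at hon'
    obtain ⟨x, -, h, h', -⟩ := hon'.exists_common hon
    exact hlm (h'.trans h)
  · have : F w < D.line t m w := by
      simp only [hF, if_neg hwl, line]
      have := mul_lt_mul_of_pos_right hd (show 0 < (D.pt t).2 - w by linarith)
      linarith
    exact this.ne hw'

theorem direction_mirror (t a : L) : D.mirror.direction t a = - D.direction t a := by
  simp only [direction, mirror]
  ring

theorem mirror_mirror : D.mirror.mirror = D := by
  cases D
  simp [mirror]

theorem IsPath.mirror {a b : L} {f : ℝ → ℝ} (h : D.IsPath a b f) :
    D.mirror.IsPath a b (fun y => - f y) where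
  continuous := h.continuous.neg
  bot := by simpa [PlanarDiagram.mirror] using h.bot
  top := by simpa [PlanarDiagram.mirror] using h.top
  onDiagram y h1 h2 := by
    rcases h.onDiagram y h1 h2 with ⟨w, h3, h4, h5⟩ | ⟨u, v, h3, h4, h5, s, t, hs, ht, hst, h6⟩
    · exact Or.inl ⟨w, h3, h4, by simp [PlanarDiagram.mirror, h5]⟩
    · refine Or.inr ⟨u, v, h3, h4, h5, s, t, hs, ht, hst, ?_⟩
      simp only [Prod.ext_iff, Prod.fst_add, Prod.snd_add, Prod.smul_fst, Prod.smul_snd,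
        smul_eq_mul, PlanarDiagram.mirror] at h6 ⊢
      exact ⟨by linarith [h6.1], h6.2⟩

theorem line_lt_path [Finite L] {g r m t : L} (hgr : g ≤ r) (hr : r ⋖ t) (hm : m ⋖ t)
    (hd : D.direction t m < D.direction t r) :
    ∃ f, D.IsPath g t f ∧ ∀ y, (D.pt g).2 ≤ y → (D.pt m).2 ≤ y → y < (D.pt t).2 →
      D.line t m y < f y := by
  obtain ⟨f, hf, h⟩ := path_lt_line (D := D.mirror) hgr hr hm
    (by simpa [direction_mirror] using hd)
  refine ⟨fun y => - f y, by simpa [mirror_mirror] using hf.mirror, fun y h1 h2 h3 => ?_⟩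
  have := h y h1 h2 h3
  simp only [line, direction_mirror] at this ⊢
  simp only [mirror] at this
  linarith

/-- Of three lower covers of `t`, the middle one is above the meet of the outer ones. -/
theorem inf_le_of_direction_lt [Finite L] {l m r t : L} (hl : l ⋖ t) (hm : m ⋖ t) (hr : r ⋖ t)
    (hlm : D.direction t l < D.direction t m) (hmr : D.direction t m < D.direction t r) :
    l ⊓ r ≤ m := by
  obtain ⟨f, hf, hf'⟩ := path_lt_line (inf_le_left : l ⊓ r ≤ l) hl hm hlm
  obtain ⟨f', hf₁, hf₁'⟩ := line_lt_path (inf_le_right : l ⊓ r ≤ r) hr hm hmr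
  have hgt := D.height_lt (inf_le_left.trans_lt hl.lt : l ⊓ r < t)
  have hmt := D.height_lt hm.lt
  -- If `l ⊓ r` is at least as high as `m`, the edge from `m` to `t` would run strictly between two
  -- paths at their common starting point.
  rcases le_or_gt (D.pt m).2 (D.pt (l ⊓ r)).2 with h | h
  · have h1 := hf' _ le_rfl h hgt
    have h2 := hf₁' _ le_rfl h hgt
    rw [hf.bot] at h1
    rw [hf₁.bot] at h2
    linarith
  -- Followed downwards, a path from `m` starts strictly between the outer paths, which close up at
  -- `l ⊓ r`. It must hit one of them, and a shared element lies above `l ⊓ r` and below `m`.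
  · obtain ⟨γ, hγ⟩ := exists_isPath (D := D) (inf_le_right : l ⊓ r ⊓ m ≤ m)
    have hz := height_le (D := D) (inf_le_left : l ⊓ r ⊓ m ≤ l ⊓ r)
    have key : ∀ F : ℝ → ℝ, D.IsPath (l ⊓ r) t F →
        (∃ w ∈ Set.uIcc (D.pt m).2 (D.pt (l ⊓ r)).2, F w = γ w) → l ⊓ r ≤ m := by
      rintro F hF ⟨w, hw, hw'⟩
      rw [Set.uIcc_of_ge h.le, Set.mem_Icc] at hw
      have h1 := hF.onDiagram w hw.1 (by linarith)
      rw [hw'] at h1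
      obtain ⟨x, h2, -, -, h3⟩ := h1.exists_common (hγ.onDiagram w (by linarith) hw.2)
      exact h2.trans h3
    have h1 := hf' _ h.le le_rfl hmt
    have h2 := hf₁' _ h.le le_rfl hmt
    rw [line_bot hm.lt, ← hγ.top] at h1 h2
    rcases le_total (γ (D.pt (l ⊓ r)).2) (D.pt (l ⊓ r)).1 with h3 | h3
    · exact key f hf (exists_eq_of_lt_of_le hf.continuous hγ.continuous h1 (by rwa [hf.bot]))
    · obtain ⟨w, hw, hw'⟩ := exists_eq_of_lt_of_le hγ.continuous hf₁.continuous h2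
        (by rwa [hf₁.bot])
      exact key f' hf₁ ⟨w, hw, hw'.symm⟩

/-- An inner lower cover of `t` has no upper cover other than `t`. -/
theorem eq_of_covBy_of_direction_lt [Finite L] {l m r t c : L} (hl : l ⋖ t) (hm : m ⋖ t)
    (hr : r ⋖ t) (hlm : D.direction t l < D.direction t m)
    (hmr : D.direction t m < D.direction t r) (hc : m ⋖ c) : c = t := by
  suffices hct : c ≤ t from (hct.eq_or_lt).resolve_right (hm.2 hc.lt)
  have hgm := inf_le_of_direction_lt hl hm hr hlm hmr
  obtain ⟨f, hf, hf'⟩ := path_lt_line (inf_le_left : l ⊓ r ≤ l) hl hm hlm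
  obtain ⟨f', hf₁, hf₁'⟩ := line_lt_path (inf_le_right : l ⊓ r ≤ r) hr hm hmr
  have hmt := D.height_lt hm.lt
  have hgm' := height_le (D := D) hgm
  have h1 := hf' _ hgm' le_rfl hmt
  have h2 := hf₁' _ hgm' le_rfl hmt
  -- The same trap upwards: a path leaving `m` through `c` starts between the outer paths, which
  -- close up at `t`. Where it meets one, it has already traversed part of the edge to `c`, so `c ≤
  -- t`.
  obtain ⟨γ, hγ⟩ := exists_isPath (D := D) (le_sup_left : c ≤ c ⊔ t)
  have hp := (isPath_line hc).trans hc.le le_sup_left hγ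
  set G : ℝ → ℝ := fun y => if y ≤ (D.pt c).2 then D.line c m y else γ y with hG
  rw [line_bot hm.lt, ← hp.bot] at h1 h2
  have htop := height_le (D := D) (le_sup_right : t ≤ c ⊔ t)
  have key : ∀ F : ℝ → ℝ, D.IsPath (l ⊓ r) t F → F (D.pt m).2 ≠ G (D.pt m).2 →
      (∃ w ∈ Set.uIcc (D.pt m).2 (D.pt t).2, F w = G w) → c ≤ t := by
    rintro F hF hne ⟨w, hw, hw'⟩
    rw [Set.uIcc_of_le hmt.le, Set.mem_Icc] at hw
    have hmw : (D.pt m).2 < w := by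
      rcases hw.1.eq_or_lt with rfl | h
      · exact absurd hw' hne
      · exact h
    have h1 := hF.onDiagram w (by linarith) hw.2
    rw [hw'] at h1
    rcases lt_or_ge w (D.pt c).2 with h | h
    · simp only [hG, if_pos h.le] at h1
      exact (h1.le_of_mem_edge hc (line_mem_edge hc.lt hmw h)).2
    · have h2 : D.OnDiagram c (c ⊔ t) (G w, w) := by
        rcases h.eq_or_lt with rfl | h
        · exact Or.inl ⟨c, le_rfl, le_sup_left, by simp [hG, line_top]⟩
        · simp only [hG, if_neg (not_le.2 h)]
          exact hγ.onDiagram w h.le (by linarith)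
      obtain ⟨x, -, h3, h4, -⟩ := h1.exists_common h2
      exact h4.trans h3
  rcases le_total (G (D.pt t).2) (D.pt t).1 with h3 | h3
  · exact key f hf h1.ne (exists_eq_of_lt_of_le hf.continuous hp.continuous h1 (by rwa [hf.top]))
  · obtain ⟨w, hw, hw'⟩ := exists_eq_of_lt_of_le hp.continuous hf₁.continuous h2
      (by rwa [hf₁.top])
    exact key f' hf₁ h2.ne' ⟨w, hw, hw'.symm⟩

variable (D) in
/-- `m` is covered by `t` and lies strictly between two other lower covers of `t`. -/
def IsInner (t m : L) : Prop :=
  m ⋖ t ∧ (∃ l, l ⋖ t ∧ D.direction t l < D.direction t m) ∧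
    ∃ r, r ⋖ t ∧ D.direction t m < D.direction t r

theorem IsInner.eq_of_covBy [Finite L] {t m c : L} (h : D.IsInner t m) (hc : m ⋖ c) : c = t := by
  obtain ⟨hm, ⟨l, hl, hlm⟩, r, hr, hmr⟩ := h
  exact eq_of_covBy_of_direction_lt hl hm hr hlm hmr hc

/-- Every lower cover of `t` has, with some other one, a meet below a given inner one. -/
theorem IsInner.exists_inf_le [Finite L] {t m a : L} (h : D.IsInner t m) (ha : a ⋖ t)
    (hne : a ≠ m) : ∃ c, c ⋖ t ∧ c ≠ m ∧ a ⊓ c ≤ m := by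
  obtain ⟨hm, ⟨l, hl, hlm⟩, r, hr, hmr⟩ := h
  rcases lt_trichotomy (D.direction t a) (D.direction t m) with h | h | h
  · exact ⟨r, hr, fun h' => (h' ▸ hmr).false, inf_le_of_direction_lt ha hm hr h hmr⟩
  · exact absurd (direction_injective ha hm h) hne
  · exact ⟨l, hl, fun h' => (h' ▸ hlm).false,
      inf_comm l a ▸ inf_le_of_direction_lt hl hm ha hlm h⟩

theorem isInner_of_lt [Finite L] {l m r t : L} (hl : l ⋖ t) (hm : m ⋖ t) (hr : r ⋖ t)
    (hlm : D.direction t l < D.direction t m) (hmr : D.direction t m < D.direction t r) :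
    D.IsInner t m ∧ l ⊓ r ≤ m ∧ r ⊓ l ≤ m :=
  ⟨⟨hm, ⟨l, hl, hlm⟩, r, hr, hmr⟩, inf_le_of_direction_lt hl hm hr hlm hmr,
    inf_comm l r ▸ inf_le_of_direction_lt hl hm hr hlm hmr⟩

variable (D) in
/-- Of three distinct lower covers, one is inner and above the meet of the others. -/
theorem exists_isInner [Finite L] {a b c t : L} (ha : a ⋖ t) (hb : b ⋖ t) (hc : c ⋖ t)
    (hab : a ≠ b) (hac : a ≠ c) (hbc : b ≠ c) :
    (D.IsInner t a ∧ b ⊓ c ≤ a) ∨ (D.IsInner t b ∧ a ⊓ c ≤ b) ∨ (D.IsInner t c ∧ a ⊓ b ≤ c) := by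
  have h1 := fun h => hab (direction_injective (D := D) ha hb h)
  have h2 := fun h => hac (direction_injective (D := D) ha hc h)
  have h3 := fun h => hbc (direction_injective (D := D) hb hc h)
  rcases lt_or_gt_of_ne h1 with h1 | h1 <;> rcases lt_or_gt_of_ne h2 with h2 | h2 <;>
    rcases lt_or_gt_of_ne h3 with h3 | h3
  · exact Or.inr (Or.inl (isInner_of_lt ha hb hc h1 h3 |>.imp_right And.left))
  · exact Or.inr (Or.inr (isInner_of_lt ha hc hb h2 h3 |>.imp_right And.left))
  · exact absurd (h1.trans h3) h2.not_gt
  · exact Or.inl (isInner_of_lt hc ha hb h2 h1 |>.imp_right And.right)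
  · exact Or.inl (isInner_of_lt hb ha hc h1 h2 |>.imp_right And.left)
  · exact absurd (h2.trans h3) h1.not_gt
  · exact Or.inr (Or.inr (isInner_of_lt hb hc ha h3 h2 |>.imp_right And.right))
  · exact Or.inr (Or.inl (isInner_of_lt hc hb ha h3 h1 |>.imp_right And.right))

theorem IsInner.three_le_ncard [Finite L] {t m : L} (h : D.IsInner t m) :
    3 ≤ {x : L | x ⋖ t}.ncard := by
  obtain ⟨hm, ⟨l, hl, hlm⟩, r, hr, hmr⟩ := h
  have h1 : l ≠ m := fun h' => (h' ▸ hlm).false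
  have h2 : m ≠ r := fun h' => (h' ▸ hmr).false
  have h3 : l ≠ r := fun h' => (h' ▸ hlm.trans hmr).false
  rw [← Set.ncard_eq_three.2 ⟨l, m, r, h1, h3, h2, rfl⟩]
  refine Set.ncard_le_ncard ?_ (Set.toFinite _)
  rintro x (rfl | rfl | rfl) <;> assumption

theorem isInner_iff {t m : L} (hm : m ⋖ t) :
    D.IsInner t m ↔ ¬ D.IsLeftmost t m ∧ ¬ D.IsRightmost t m := by
  simp [IsInner, IsLeftmost, IsRightmost, hm]

end PlanarDiagram

end Geometry

theorem EqvGen.map {α : Type*} {r : α → α → Prop} {f : α → α}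
    (h : ∀ a b, r a b → Relation.EqvGen r (f a) (f b)) {a b : α} (hab : Relation.EqvGen r a b) :
    Relation.EqvGen r (f a) (f b) := by
  induction hab with
  | rel _ _ hr => exact h _ _ hr
  | refl _ => exact .refl _
  | symm _ _ _ ih => exact ih.symm
  | trans _ _ _ _ _ ih ih' => exact ih.trans _ _ _ ih'

/-! ### Perspectivities and slide–swing steps. -/

section Lattice

variable {L : Type*} [Lattice L]

theorem inf_eq_of_covBy {a b c : L} (h : a ⋖ b) (hac : a ≤ c) (hbc : ¬ b ≤ c) : b ⊓ c = a :=
  (h.eq_or_eq (le_inf h.le hac) inf_le_left).resolve_right fun h' => hbc (inf_eq_left.1 h')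

theorem covBy_sup_of_not_le [IsUpperModularLattice L] {a b c : L} (h : a ⋖ b) (hac : a ≤ c)
    (hbc : ¬ b ≤ c) : c ⋖ b ⊔ c := by
  apply covBy_sup_of_inf_covBy_left
  rwa [inf_eq_of_covBy h hac hbc]

theorem eq_of_covBy_of_le {a b c : L} (hb : a ⋖ b) (hc : a ⋖ c) (hbc : b ≤ c) : b = c :=
  (hc.eq_or_eq hb.le hbc).resolve_left hb.lt.ne'

/-- Since both intervals are prime, the two equations reduce to inequalities, the form used
everywhere below. -/
theorem upPersp_iff {p q : PrimeInterval L} :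
    UpPersp p q ↔ p.bot ≤ q.bot ∧ p.top ≤ q.top ∧ ¬ p.top ≤ q.bot := by
  constructor
  · rintro ⟨h1, h2⟩
    refine ⟨h1 ▸ inf_le_right, h2 ▸ le_sup_left, fun h => ?_⟩
    rw [inf_eq_left.2 h] at h1
    exact p.covBy.lt.ne' h1
  · rintro ⟨h1, h2, h3⟩
    refine ⟨inf_eq_of_covBy p.covBy h1 h3, ?_⟩
    exact (q.covBy.eq_or_eq le_sup_right (sup_le h2 q.covBy.le)).resolve_left
      fun h => h3 (sup_eq_right.1 h)

theorem downPersp_iff {p q : PrimeInterval L} : DownPersp p q ↔ UpPersp q p := by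
  rw [DownPersp, UpPersp, sup_comm, inf_comm, and_comm]

theorem UpPersp.refl (p : PrimeInterval L) : UpPersp p p :=
  upPersp_iff.2 ⟨le_rfl, le_rfl, p.covBy.lt.not_ge⟩

theorem UpPersp.trans {p q r : PrimeInterval L} (h : UpPersp p q) (h' : UpPersp q r) :
    UpPersp p r := by
  have h2 := h.2
  rw [upPersp_iff] at *
  refine ⟨h.1.trans h'.1, h.2.1.trans h'.2.1, fun hle => h'.2.2 ?_⟩
  rw [← h2]
  exact sup_le hle h'.1

variable (D : PlanarDiagram L)

/-- One step of a slide–swing sequence. -/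
def Step (p q : PrimeInterval L) : Prop :=
  DownPersp p q ∨ Swings D p q

/-- `q` can be reached from `p` by an up-perspectivity followed by down-perspectivities and
swings. -/
def Reachable (p q : PrimeInterval L) : Prop :=
  ∃ r, UpPersp p r ∧ Relation.ReflTransGen (Step D) r q

variable {D}

theorem Step.top_le {p q : PrimeInterval L} (h : Step D p q) : q.top ≤ p.top := by
  rcases h with h | h
  · exact (upPersp_iff.1 (downPersp_iff.1 h)).2.1
  · exact h.1.ge

theorem Swings.isInner {p q : PrimeInterval L} (h : Swings D p q) : D.IsInner q.top q.bot :=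
  (PlanarDiagram.isInner_iff q.covBy).2 h.2.2

theorem swings_of_isInner [Finite L] {p q : PrimeInterval L} (h : p.top = q.top)
    (hq : D.IsInner q.top q.bot) : Swings D p q :=
  ⟨h, hq.three_le_ncard, (PlanarDiagram.isInner_iff q.covBy).1 hq⟩

theorem exists_isSlideSwingSeq_iff {r q : PrimeInterval L} :
    (∃ (n : ℕ) (s : Fin (n + 1) → PrimeInterval L), IsSlideSwingSeq D r q n s) ↔
      Relation.ReflTransGen (Step D) r q := by
  constructor
  · rintro ⟨n, s, h0, hn, hs⟩
    have : ∀ i : Fin (n + 1), Relation.ReflTransGen (Step D) r (s i) := fun i => by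
      induction i using Fin.induction with
      | zero => rw [h0]
      | succ i ih => exact ih.tail (hs i)
    exact hn ▸ this (Fin.last n)
  · intro h
    induction h using Relation.ReflTransGen.head_induction_on with
    | refl => exact ⟨0, fun _ => q, rfl, rfl, fun i => i.elim0⟩
    | @head p r hpr _ ih =>
      obtain ⟨n, s, h0, hn, hs⟩ := ih
      refine ⟨n + 1, Fin.cons p s, rfl, ?_, fun i => ?_⟩
      · rw [← Fin.succ_last, Fin.cons_succ, hn]
      · induction i using Fin.cases with
        | zero => simpa [h0, Step] using hpr
        | succ i => simpa [Fin.castSucc_succ] using hs i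

theorem IsSlideSwingSeq.antitone {r q : PrimeInterval L} {n : ℕ}
    {s : Fin (n + 1) → PrimeInterval L} (h : IsSlideSwingSeq D r q n s) :
    Antitone fun i => (s i).top :=
  Fin.antitone_iff_succ_le.2 fun i => Step.top_le (h.2.2 i)

/-- In a slim semimodular planar lattice no element has three upper covers. -/
theorem IsSlim.not_three_covBy [Finite L] [IsUpperModularLattice L] (hslim : IsSlim L)
    (D : PlanarDiagram L) {o x y z : L} (hx : o ⋖ x) (hy : o ⋖ y) (hz : o ⋖ z) (hxy : x ≠ y)
    (hxz : x ≠ z) (hyz : y ≠ z) : False := by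
  have key : ∀ {x y z : L}, o ⋖ x → o ⋖ y → o ⋖ z → x ≠ y → x ≠ z → y ≠ z → x ≤ y ⊔ z →
      False := by
    intro x y z hx hy hz hxy hxz hyz h
    have nle : ∀ {a b : L}, o ⋖ a → o ⋖ b → a ≠ b → ¬ a ≤ b := fun ha hb hab h =>
      hab (eq_of_covBy_of_le ha hb h)
    have hinf : ∀ {a b : L}, o ⋖ a → o ⋖ b → a ≠ b → a ⊓ b = o := fun ha hb hab =>
      inf_eq_of_covBy ha hb.le (nle ha hb hab)
    -- By semimodularity both joins cover `y`, so being comparable they coincide; the three upper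
    -- covers then span an M₃.
    have h1 : x ⊔ y = y ⊔ z := eq_of_covBy_of_le (covBy_sup_of_not_le hx hy.le (nle hx hy hxy))
      (sup_comm y z ▸ covBy_sup_of_not_le hz hy.le (nle hz hy hyz.symm)) (sup_le h le_sup_left)
    have h2 : x ⊔ z = y ⊔ z := eq_of_covBy_of_le (covBy_sup_of_not_le hx hz.le (nle hx hz hxz))
      (covBy_sup_of_not_le hy hz.le (nle hy hz hyz)) (sup_le h le_sup_right)
    refine hslim ⟨o, x, y, z, y ⊔ z, ?_, ⟨hinf hx hy hxy, hinf hx hz hxz, hinf hy hz hyz⟩,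
      h1, h2, rfl⟩
    have hy' : y ≠ y ⊔ z := fun h' => nle hz hy hyz.symm (h'.symm ▸ le_sup_right)
    have hz' : z ≠ y ⊔ z := fun h' => nle hy hz hyz (h'.symm ▸ le_sup_left)
    have hx' : x ≠ y ⊔ z := fun h' => nle hy hx hxy.symm (h'.symm ▸ le_sup_left)
    have ho' : o ≠ y ⊔ z := (hy.lt.trans_le le_sup_left).ne
    simp [hxy, hxz, hyz, hx', hy', hz', ho', hx.lt.ne, hy.lt.ne, hz.lt.ne]
  -- In the dual diagram upper covers are lower covers, so the middle one lies below the join of the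
  -- other two.
  rcases D.dual.exists_isInner hx.toDual hy.toDual hz.toDual (by simpa using hxy)
    (by simpa using hxz) (by simpa using hyz) with h | h | h
  · exact key hx hy hz hxy hxz hyz h.2
  · exact key hy hx hz hxy.symm hyz hxz h.2
  · exact key hz hx hy hxz.symm hyz.symm hxy h.2

/-! ### Closure of reachability under meets and up-perspectivities. -/

/-- Induction moves `q` upwards: semimodularity builds a covering square on `q` with top `t`, and
either its upper edge [x, t] still satisfies the hypotheses, or another edge [y, t] does and swings
to it. -/
theorem reflTransGen_step_of_inf_le [Finite L] [IsUpperModularLattice L] {p : PrimeInterval L}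
    (q : PrimeInterval L) (hle : q.top ≤ p.top) (hinf : p.bot ⊓ q.top ≤ q.bot) :
    Relation.ReflTransGen (Step D) p q := by
  obtain ⟨v, hv⟩ : ∃ v, q.top = v := ⟨_, rfl⟩
  induction v using WellFoundedGT.induction generalizing q with
  | ind v ih =>
  subst hv
  by_cases hu : q.bot ≤ p.bot
  · refine .single (Or.inl (downPersp_iff.2 (upPersp_iff.2 ⟨hu, hle, fun h => ?_⟩)))
    rw [inf_eq_right.2 h] at hinf
    exact q.covBy.lt.not_ge hinf
  have hap : ¬ p.bot ≤ q.top := fun h => by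
    rw [inf_eq_left.2 h] at hinf
    exact p.covBy.2 (lt_of_le_not_ge hinf hu) (q.covBy.lt.trans_le hle)
  obtain ⟨z, hz, hzp⟩ := exists_covBy_le_of_lt (inf_lt_left.2 hap)
  have hzq : ¬ z ≤ q.top := fun h => hz.lt.not_ge (le_inf hzp h)
  have hqx := covBy_sup_of_not_le hz hinf fun h => hzq (h.trans q.covBy.le)
  set x := z ⊔ q.bot with hx
  have hzx : z ≤ x := le_sup_left
  have hxq : ¬ x ≤ q.top := fun h => hzq (hzx.trans h)
  have hqx' : ¬ q.top ≤ x := fun h => hxq (eq_of_covBy_of_le q.covBy hqx h).ge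
  have hxt := covBy_sup_of_not_le q.covBy hqx.le hqx'
  have hvt := covBy_sup_of_not_le hqx q.covBy.le hxq
  rw [sup_comm] at hvt
  set t := q.top ⊔ x with ht
  have htp : t ≤ p.top :=
    sup_le hle (sup_le (hzp.trans p.covBy.le) (q.covBy.le.trans hle))
  have hdown : Step D ⟨x, t, hxt⟩ q :=
    Or.inl (downPersp_iff.2 (upPersp_iff.2 ⟨hqx.le, hvt.le, hqx'⟩))
  by_cases hax : p.bot ⊓ t ≤ x
  · exact (ih t hvt.lt ⟨x, t, hxt⟩ htp hax rfl).tail hdown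
  have hlt : p.bot ⊓ t < t := inf_lt_right.2 fun h => hu (hqx.le.trans (hxt.le.trans h))
  obtain ⟨y, hy, hyt⟩ := exists_le_covBy_of_lt hlt
  have hyx : x ≠ y := fun h => hax (h ▸ hy)
  have hyv : q.top ≠ y := fun h =>
    hax ((le_inf inf_le_left (h ▸ hy)).trans (hinf.trans hqx.le))
  have hzy : z ≤ y := (le_inf hzp (hzx.trans hxt.le)).trans hy
  have huy : ¬ q.bot ≤ y := fun h =>
    hyx ((hxt.eq_or_eq (sup_le hzy h) hyt.le).resolve_right hyt.lt.ne).symm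
  -- Of the lower covers `q.top`, `x`, `y` of `t`, only `x` can be the middle one: `z` lies below `x
  -- ⊓ y` but not below `q.top`, and `q.bot` lies below `q.top ⊓ x` but not below `y`.
  rcases D.exists_isInner hvt hxt hyt (fun h => hxq h.ge) hyv hyx with h | h | h
  · exact absurd ((le_inf hzx hzy).trans h.2) hzq
  · have hswing : Swings D ⟨y, t, hyt⟩ ⟨x, t, hxt⟩ := swings_of_isInner rfl h.1
    exact ((ih t hvt.lt ⟨y, t, hyt⟩ htp hy rfl).tail (Or.inr hswing)).tail hdown
  · exact absurd ((le_inf q.covBy.le hqx.le).trans h.2) huy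

theorem Reachable.of_inf_le [Finite L] [IsUpperModularLattice L] {p q q' : PrimeInterval L}
    (h : Reachable D p q) (hle : q'.top ≤ q.top) (hinf : q.bot ⊓ q'.top ≤ q'.bot) :
    Reachable D p q' := by
  obtain ⟨r, hr, h⟩ := h
  exact ⟨r, hr, h.trans (reflTransGen_step_of_inf_le q' hle hinf)⟩

/-- Look at the last step into `q`. After a swing, `q.bot` has only one upper cover, so no such `q'`
exists. After a slide from `s`, either `s` slides to `q'` directly, or `s = q` and the induction
applies, or `q.bot` has three upper covers. -/
theorem Reachable.upPersp_of_covBy [Finite L] [IsUpperModularLattice L] (hslim : IsSlim L)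
    {p q q' : PrimeInterval L} (h : Reachable D p q) (hq : UpPersp q q') (hc : q.bot ⋖ q'.bot) :
    Reachable D p q' := by
  obtain ⟨r, hr, h⟩ := h
  induction h with
  | refl => exact ⟨q', hr.trans hq, .refl⟩
  | @tail s q hs hsq ih =>
    have hq' := upPersp_iff.1 hq
    rcases hsq with hsq | hsq
    · have hsq' := upPersp_iff.1 (downPersp_iff.1 hsq)
      by_cases hle : q'.bot ≤ s.bot
      · refine ⟨r, hr, hs.tail (Or.inl (downPersp_iff.2 (upPersp_iff.2 ⟨hle, ?_, fun h =>
          hsq'.2.2 (hq'.2.1.trans h)⟩)))⟩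
        rw [← hq.2]
        exact sup_le hsq'.2.1 (hle.trans s.covBy.le)
      rcases hsq'.1.eq_or_lt with heq | hlt
      · obtain rfl : q = s :=
          PrimeInterval.ext heq (eq_of_covBy_of_le q.covBy (heq ▸ s.covBy) hsq'.2.1)
        exact ih hq hc
      · obtain ⟨e, he, hes⟩ := exists_covBy_le_of_lt hlt
        exact (hslim.not_three_covBy D q.covBy hc he (fun h => hq'.2.2 h.le)
          (fun h => hsq'.2.2 (h ▸ hes)) (fun h => hle (h ▸ hes))).elim
    · exact absurd (hsq.isInner.eq_of_covBy hc).ge hq'.2.2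

theorem Reachable.upPersp [Finite L] [IsUpperModularLattice L] (hslim : IsSlim L)
    {p q q' : PrimeInterval L} (h : Reachable D p q) (hq : UpPersp q q') : Reachable D p q' := by
  obtain ⟨a, ha⟩ : ∃ a, q.bot = a := ⟨_, rfl⟩
  induction a using WellFoundedGT.induction generalizing q with
  | ind a ih =>
  subst ha
  have hq' := upPersp_iff.1 hq
  rcases hq'.1.eq_or_lt with heq | hlt
  · obtain rfl : q = q' :=
      PrimeInterval.ext heq (eq_of_covBy_of_le q.covBy (heq ▸ q'.covBy) hq'.2.1)
    exact h
  · obtain ⟨c, hc, hcq⟩ := exists_covBy_le_of_lt hlt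
    have hqc : ¬ q.top ≤ c := fun h => hq'.2.2 (h.trans hcq)
    let e : PrimeInterval L := ⟨c, q.top ⊔ c, covBy_sup_of_not_le q.covBy hc.le hqc⟩
    have he : UpPersp q e := upPersp_iff.2 ⟨hc.le, le_sup_left, hqc⟩
    exact ih c hc.lt (h.upPersp_of_covBy hslim he hc)
      (upPersp_iff.2 ⟨hcq, sup_le hq'.2.1 (hcq.trans q'.covBy.le), fun h =>
        hq'.2.2 (le_sup_left.trans h)⟩) rfl

/-! ### The congruence generated by reachable intervals. -/

variable (D) in
/-- `a` and `b` are the ends of a prime interval reachable from `p`. -/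
def ReachableEdge (p : PrimeInterval L) (a b : L) : Prop :=
  ∃ q, Reachable D p q ∧ q.bot = a ∧ q.top = b

theorem eqvGen_of_forall_covBy [Finite L] {r : L → L → Prop} {a b : L} (hab : a ≤ b)
    (h : ∀ u v, a ≤ u → u ⋖ v → v ≤ b → r u v) : Relation.EqvGen r a b := by
  induction b using WellFoundedLT.induction with
  | ind b ih =>
    rcases hab.eq_or_lt with rfl | hab
    · exact .refl _
    · obtain ⟨u, hau, hub⟩ := exists_le_covBy_of_lt hab
      exact (ih u hub.lt hau fun x y h1 h2 h3 => h x y h1 h2 (h3.trans hub.le)).trans _ _ _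
        (.rel _ _ (h u b hau hub le_rfl))

theorem ReachableEdge.sup [Finite L] [IsUpperModularLattice L] (hslim : IsSlim L)
    {p : PrimeInterval L} {a b : L} (h : ReachableEdge D p a b) (c : L) :
    Relation.EqvGen (ReachableEdge D p) (a ⊔ c) (b ⊔ c) := by
  obtain ⟨q, hq, rfl, rfl⟩ := h
  by_cases hle : q.top ≤ q.bot ⊔ c
  · rw [le_antisymm (sup_le hle le_sup_right) (sup_le_sup_right q.covBy.le c)]
    exact .refl _
  · have hcov := covBy_sup_of_not_le q.covBy (le_sup_left : q.bot ≤ q.bot ⊔ c) hle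
    have heq : q.top ⊔ (q.bot ⊔ c) = q.top ⊔ c := by
      rw [← sup_assoc, sup_eq_left.2 q.covBy.le]
    exact .rel _ _ ⟨⟨_, _, hcov⟩, hq.upPersp hslim (upPersp_iff.2 ⟨le_sup_left, le_sup_left, hle⟩),
      rfl, heq⟩

theorem ReachableEdge.inf [Finite L] [IsUpperModularLattice L]
    {p : PrimeInterval L} {a b : L} (h : ReachableEdge D p a b) (c : L) :
    Relation.EqvGen (ReachableEdge D p) (a ⊓ c) (b ⊓ c) := by
  obtain ⟨q, hq, rfl, rfl⟩ := h
  refine eqvGen_of_forall_covBy (inf_le_inf_right c q.covBy.le) fun u v hu huv hv => ?_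
  exact ⟨⟨u, v, huv⟩, hq.of_inf_le (hv.trans inf_le_left)
    ((inf_le_inf_left _ (hv.trans inf_le_right)).trans hu), rfl, rfl⟩

/-- The congruence generated by the prime intervals reachable from `p`. -/
def reachableCon [Finite L] [IsUpperModularLattice L] (hslim : IsSlim L) (D : PlanarDiagram L)
    (p : PrimeInterval L) : LatticeCon L where
  toSetoid := Relation.EqvGen.setoid (ReachableEdge D p)
  inf {w x y z} h h' := by
    have h1 := EqvGen.map (f := (· ⊓ y)) (fun _ _ h => h.inf y) h
    have h2 := EqvGen.map (f := (· ⊓ x)) (fun _ _ h => h.inf x) h'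
    simp only [inf_comm _ x] at h2
    exact h1.trans _ _ _ h2
  sup {w x y z} h h' := by
    have h1 := EqvGen.map (f := (· ⊔ y)) (fun _ _ h => h.sup hslim y) h
    have h2 := EqvGen.map (f := (· ⊔ x)) (fun _ _ h => h.sup hslim x) h'
    simp only [sup_comm _ x] at h2
    exact h1.trans _ _ _ h2

/-- A prime interval collapsed by the congruence generated by the reachable prime intervals is
reachable. -/
theorem reachable_of_eqvGen [Finite L] [IsUpperModularLattice L] (hslim : IsSlim L)
    {p q : PrimeInterval L} (h : Relation.EqvGen (ReachableEdge D p) q.bot q.top) :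
    Reachable D p q := by
  by_contra hq
  -- The map x ↦ (x ⊔ q.bot) ⊓ q.top takes values in {q.bot, q.top}. If it changed along a reachable
  -- edge, joining that edge with `q.bot` and then going down would reach `q`.
  have key : ∀ a b, Relation.EqvGen (ReachableEdge D p) a b →
      (a ⊔ q.bot) ⊓ q.top = (b ⊔ q.bot) ⊓ q.top := by
    intro a b hab
    induction hab with
    | refl _ => rfl
    | symm _ _ _ ih => exact ih.symm
    | trans _ _ _ _ _ ih ih' => exact ih.trans ih'
    | rel a b hr =>
      obtain ⟨e, he, rfl, rfl⟩ := hr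
      refine le_antisymm (inf_le_inf_right _ (sup_le_sup_right e.covBy.le _)) ?_
      by_contra hn
      have hle : ¬ e.top ≤ e.bot ⊔ q.bot := fun h =>
        hn (inf_le_inf_right _ (sup_le h le_sup_right))
      have hcov := covBy_sup_of_not_le e.covBy (le_sup_left : e.bot ≤ e.bot ⊔ q.bot) hle
      have he' : Reachable D p ⟨_, _, hcov⟩ :=
        he.upPersp hslim (upPersp_iff.2 ⟨le_sup_left, le_sup_left, hle⟩)
      have hqe : ¬ q.top ≤ e.bot ⊔ q.bot := fun h =>
        hn (le_inf (inf_le_right.trans h) inf_le_right)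
      have hqt : q.top ≤ e.top ⊔ q.bot := by
        by_contra hqt
        refine hn ?_
        rw [inf_comm, inf_eq_of_covBy q.covBy le_sup_right hqt]
        exact le_inf le_sup_right q.covBy.le
      refine hq (he'.of_inf_le (hqt.trans (sup_le_sup_left le_sup_right _)) ?_)
      rw [inf_comm, inf_eq_of_covBy q.covBy le_sup_right hqe]
  have := key _ _ h
  rw [sup_idem, inf_eq_left.2 q.covBy.le, sup_eq_left.2 q.covBy.le, inf_idem] at this
  exact q.covBy.lt.ne this

/-! ### Moves preserve collapse. -/

theorem Collapsed.upPersp {c : LatticeCon L} {p q : PrimeInterval L} (h : Collapsed c p)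
    (hpq : UpPersp p q) : Collapsed c q := by
  have := c.sup h (c.refl q.bot)
  rwa [hpq.2, sup_eq_right.2 (upPersp_iff.1 hpq).1] at this

theorem Collapsed.step [Finite L] {c : LatticeCon L} {p q : PrimeInterval L} (h : Collapsed c p)
    (hpq : Step D p q) : Collapsed c q := by
  rcases hpq with hpq | hpq
  · have := c.inf h (c.refl q.top)
    rwa [hpq.2, inf_eq_right.2 (upPersp_iff.1 (downPersp_iff.1 hpq)).2.1] at this
  · by_cases hne : p.bot = q.bot
    · rwa [PrimeInterval.ext hne hpq.1] at h
    -- Meeting p with a lower cover `a` on the other side of `q.bot` identifies `p.bot ⊓ a`, which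
    -- is below `q.bot`, with `a`; joining with `q.bot` then identifies `q.bot` with `q.top`.
    · obtain ⟨a, ha, hne', hle⟩ := hpq.isInner.exists_inf_le (hpq.1 ▸ p.covBy) hne
      have := c.sup (c.inf h (c.refl a)) (c.refl q.bot)
      rw [hpq.1, inf_eq_right.2 ha.le, sup_eq_right.2 hle] at this
      rwa [(q.covBy.eq_or_eq le_sup_right (sup_le ha.le q.covBy.le)).resolve_left] at this
      intro h'
      exact hne' ((ha.eq_or_eq (sup_eq_right.1 h') q.covBy.le).resolve_right q.covBy.lt.ne).symm

end Lattice

end SwingLemma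

open SwingLemma in
theorem mainTheorem1 {L : Type*} [Lattice L] [Finite L] [IsUpperModularLattice L]
    (hslim : IsSlim L) (D : PlanarDiagram L) (p q : PrimeInterval L) (hpq : p ≠ q) :
    (Collapsed (con p) q ↔
      ∃ r : PrimeInterval L, UpPersp p r ∧
        ∃ (n : ℕ) (s : Fin (n + 1) → PrimeInterval L), IsSlideSwingSeq D r q n s) ∧
    (∀ r : PrimeInterval L, UpPersp p r →
      ∀ (n : ℕ) (s : Fin (n + 1) → PrimeInterval L), IsSlideSwingSeq D r q n s →
        ∀ i j : Fin (n + 1), i ≤ j → (s j).top ≤ (s i).top) := by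
  refine ⟨?_, fun r _ n s hs i j hij => hs.antitone hij⟩
  simp only [exists_isSlideSwingSeq_iff]
  constructor
  · intro h
    exact reachable_of_eqvGen hslim
      (h (reachableCon hslim D p) (.rel _ _ ⟨p, ⟨p, .refl p, .refl⟩, rfl, rfl⟩))
  · rintro ⟨r, hr, h⟩
    have hp : Collapsed (con p) p := fun _ hc => hc
    have hr' := hp.upPersp hr
    clear hr hpq
    induction h with
    | refl => exact hr'
    | tail _ hs ih => exact ih.step hs
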